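/- All rings are commutative with unit. For a ring $A$, a regular element is a non-zero-divisor, $\mathrm{Reg}(A)$ is the set of regular elements, and $K$ is the total quotient ring of $A$. An ideal is regular if it contains a regular element, and a minimal regular prime is a minimal element of the set of regular prime ideals. An overring of $A$ is a ring $B$ with $A\subseteq B\subseteq K$; it is unibranched if the contraction map $\mathrm{Spec}(B)\to\mathrm{Spec}(A)$ is bijective. The ring $A$ is perinormal if every overring $B$ of $A$ such that $A\subseteq B$ satisfies going down is flat as an $A$-module. For a prime ideal $P$ of $A$, the regular quotient ring $A_{(P)}\subseteq K$ is the fraction ring of $A$ with denominators in $(A\setminus P)\cap \mathrm{Reg}(A)$; its total quotient ring is again $K$. A subring $V$ of $K$ is a (Manis) discrete valuation ring (DVR) on $K$ if $V=\{x\in K\mid v(x)\ge 0\}$ for some surjective map $v:K\to\mathbb{Z}\cup\{\infty\}$ with $v(xy)=v(x)+v(y)$, $v(x+y)\ge\min\{v(x),v(y)\}$ for all $x,y\in K$, $v(1)=0$ and $v(0)=\infty$. **Theorem.** Let $A$ be a Noetherian ring with total quotient ring $K$, and let $A'$ be the integral closure of $A$ in $K$. Assume that $A_{(P\cap A)}$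 is a DVR on $K$ for every minimal regular prime $P$ of $A'$. Then the following are equivalent. (a) $A$ is perinormal. (b) Whenever $P$ is a prime ideal of $A$ and $B$ is an integral unibranched overring of $A_{(P)}$, we have $A_{(P)}=B$. -/

import Mathlib

open scoped nonZeroDivisors WithZero

/-- An ideal is regular if it contains a regular element (a non-zero-divisor). -/
def IsRegularIdeal {R : Type*} [CommRing R] (I : Ideal R) : Prop :=
  ∃ x ∈ I, x ∈ R⁰

/-- A minimal regular prime: a minimal element of the set of regular prime ideals. -/
def IsMinimalRegularPrime {R : Type*} [CommRing R] (P : Ideal R) : Prop :=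
  Minimal (fun Q : Ideal R => Q.IsPrime ∧ IsRegularIdeal Q) P

/-- The regular quotient ring `A_(P)`: the fraction ring of `A` with denominators the regular
elements of `A` outside `P`, as a subring of the total quotient ring `K` of `A`. -/
noncomputable def regularQuotient {A : Type*} [CommRing A] (K : Type*) [CommRing K] [Algebra A K]
    [IsFractionRing A K] (P : Ideal A) [P.IsPrime] : Subalgebra A K :=
  Localization.subalgebra K (P.primeCompl ⊓ A⁰) inf_le_right

/-- A subring `V` of `K` is a (rank one) discrete Manis valuation ring on `K` if it is the ring of
a surjective valuation `K → ℤ ∪ {∞}` (written multiplicatively, with reversed order). -/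
def IsManisDVR {K : Type*} [CommRing K] (V : Subring K) : Prop :=
  ∃ v : Valuation K ℤᵐ⁰, Function.Surjective v ∧ v.integer = V

/-- `A`, with total quotient ring `K`, is perinormal if every overring `B` of `A` (a ring between
`A` and `K`) such that `A ⊆ B` satisfies going down is flat over `A`. -/
def IsPerinormal (A K : Type*) [CommRing A] [CommRing K] [Algebra A K] [IsFractionRing A K] :
    Prop :=
  ∀ B : Subalgebra A K, Algebra.HasGoingDown A B → Module.Flat A B

/-- `A ⊆ B` is unibranched if the contraction map `Spec B → Spec A` is bijective. -/
def IsUnibranched (A B : Type*) [CommRing A] [CommRing B] [Algebra A B] : Prop :=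
  Function.Bijective (PrimeSpectrum.comap (algebraMap A B))

/-!
(a) ⇒ (b): an integral unibranched overring of `A_(P)` satisfies going down, so perinormality makes
it faithfully flat, and the only faithfully flat overring is the trivial one.

(b) ⇒ (a): let `A ⊆ B` satisfy going down, let `Q` be a prime of `B`, `P = Q ∩ A`, and let `C` be
the localization of `B` at the regular elements of `A` outside `P`. In an extension of `A` inside
`B` that is integral over `A`, only one prime lies over a given regular prime `p ⊆ P`, namely the
contraction of any prime of `B` over `p`: to see this, generalize to codimension one, where `A` is
integrally closed, and go down.
Hence the integral closure of `A_(P)` in `C` is unibranched, and equals `A_(P)` by (b). Then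
`C = A_(P)`: an associated prime `p = (A_(P) : y)` of `C / A_(P)` is contracted from `C`, whence
`y p ⊆ p` and `y` is integral over `A_(P)`, a contradiction. So `B` is locally flat over `A`.
-/

section RegularIdeal

variable (A K : Type*) [CommRing A] [CommRing K] [Algebra A K] [IsFractionRing A K]

theorem mem_nonZeroDivisors_iff_isUnit_algebraMap {x : A} :
    x ∈ A⁰ ↔ IsUnit (algebraMap A K x) :=
  ⟨fun hx => IsLocalization.map_units K (⟨x, hx⟩ : A⁰), fun hx =>
    mem_nonZeroDivisors_of_injective (IsFractionRing.injective A K) hx.mem_nonZeroDivisors⟩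

variable {A K} in
instance isFractionRing_overring (T : Subalgebra A K) : IsFractionRing T K where
  map_units := by
    rintro ⟨x, hx⟩
    obtain ⟨⟨a, s⟩, has⟩ := IsLocalization.surj A⁰ (x : K)
    have hs : IsUnit (algebraMap A K s) := IsLocalization.map_units K s
    have ha : a ∈ A⁰ := by
      rw [mem_nonZeroDivisors_iff_right]
      intro c hc
      have hxc : algebraMap A T c * x = 0 := Subtype.ext <| hs.mul_left_injective <|
        calc algebraMap A K c * x * algebraMap A K s = algebraMap A K c * (x * algebraMap A K s) :=
              mul_assoc _ _ _
          _ = 0 * algebraMap A K s := by rw [has, ← map_mul, hc, map_zero, zero_mul]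
      have hc0 := (mem_nonZeroDivisors_iff_right.1 hx) _ hxc
      exact IsFractionRing.injective A K ((congrArg Subtype.val hc0).trans (map_zero _).symm)
    rw [mem_nonZeroDivisors_iff_isUnit_algebraMap A K, ← has] at ha
    exact isUnit_of_mul_isUnit_left ha
  surj x := by
    obtain ⟨⟨a, s⟩, has⟩ := IsLocalization.surj A⁰ x
    have hs : algebraMap A T s ∈ T⁰ := mem_nonZeroDivisors_of_injective (f := algebraMap T K)
      Subtype.val_injective (IsLocalization.map_units K s).mem_nonZeroDivisors
    exact ⟨(algebraMap A T a, ⟨_, hs⟩), has⟩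
  exists_of_eq h := ⟨1, congrArg _ (Subtype.ext h)⟩

variable {A} in
theorem isRegularIdeal_under_iff {T : Type*} [CommRing T] [Algebra A T] [Algebra T K]
    [IsScalarTower A T K] [IsFractionRing T K] {I : Ideal T} :
    IsRegularIdeal (I.under A) ↔ IsRegularIdeal I := by
  constructor
  · rintro ⟨x, hxI, hx⟩
    refine ⟨_, hxI, ?_⟩
    rwa [mem_nonZeroDivisors_iff_isUnit_algebraMap T K, ← IsScalarTower.algebraMap_apply,
      ← mem_nonZeroDivisors_iff_isUnit_algebraMap A K]
  · rintro ⟨x, hxI, hx⟩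
    obtain ⟨⟨a, s⟩, has⟩ := IsLocalization.surj A⁰ (algebraMap T K x)
    have hxs : x * algebraMap A T s = algebraMap A T a := IsFractionRing.injective T K <| by
      rwa [map_mul, ← IsScalarTower.algebraMap_apply, ← IsScalarTower.algebraMap_apply]
    refine ⟨a, ?_, ?_⟩
    · rw [Ideal.under_def, Ideal.mem_comap, ← hxs]
      exact I.mul_mem_right _ hxI
    · rw [mem_nonZeroDivisors_iff_isUnit_algebraMap A K, ← has]
      exact ((mem_nonZeroDivisors_iff_isUnit_algebraMap T K).1 hx).mul
        (IsLocalization.map_units K s)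

theorem IsRegularIdeal.exists_mem_nonZeroDivisors_notMem {R : Type*} [CommRing R]
    [IsNoetherianRing R] {I P : Ideal R} [P.IsPrime] (hI : IsRegularIdeal I) (hIP : ¬ I ≤ P) :
    ∃ x ∈ I, x ∈ R⁰ ∧ x ∉ P := by
  have mem_zeroDivisors (x : R) : x ∈ ⋃ J ∈ associatedPrimes R R, (J : Set R) ↔ x ∉ R⁰ := by
    rw [biUnion_associatedPrimes_eq_compl_nonZeroDivisors]
    rfl
  by_contra! h
  have hsub : (I : Set R) ⊆ ⋃ J ∈ insert P (associatedPrimes R R), (J : Set R) := by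
    intro x hx
    rw [Set.biUnion_insert]
    exact or_iff_not_imp_right.2 fun hx' => h x hx (not_not.1 (mt (mem_zeroDivisors x).2 hx'))
  obtain ⟨J, rfl | hJ, hIJ⟩ :=
    (I.subset_union_prime_finite (f := id) ((associatedPrimes.finite R R).insert P) P P
      fun J hJ hJP _ => (hJ.resolve_left hJP).isPrime).1 hsub
  · exact hIP hIJ
  · obtain ⟨x, hxI, hx⟩ := hI
    exact (mem_zeroDivisors x).1 (Set.mem_biUnion hJ (hIJ hxI)) hx

end RegularIdeal

section MinimalRegularPrime

theorem isMinimalRegularPrime_of_mem_minimalPrimes_span_singleton {T : Type*} [CommRing T]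
    [IsNoetherianRing T] {b : T} (hb : b ∈ T⁰) {n : Ideal T}
    (hn : n ∈ (Ideal.span {b}).minimalPrimes) : IsMinimalRegularPrime n := by
  have : n.IsPrime := hn.1.1
  refine ⟨⟨this, b, hn.1.2 (Ideal.mem_span_singleton_self b), hb⟩, ?_⟩
  rintro m ⟨hm, c, hcm, hc⟩ hmn
  by_contra hnm
  have hn1 : n.height ≤ 1 := Ideal.height_le_one_of_isPrincipal_of_mem_minimalPrimes _ n hn
  have hm0 : m.height = 0 := by
    have := (Ideal.height_add_one_le_of_lt_of_isPrime (lt_of_le_not_ge hmn hnm)).trans hn1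
    simpa using (ENat.add_le_add_iff_right ENat.one_ne_top).1 (this.trans_eq (zero_add 1).symm)
  rw [Ideal.height_eq_zero_iff] at hm0
  exact Set.disjoint_left.1 (Ideal.disjoint_nonZeroDivisors_of_mem_minimalPrimes hm0) hcm hc

theorem exists_isMinimalRegularPrime_under_eq {T : Type*} (T' K : Type*) [CommRing T] [CommRing T']
    [CommRing K] [Algebra T T'] [Algebra T K] [Algebra T' K] [IsScalarTower T T' K]
    [IsFractionRing T K] [IsFractionRing T' K] [Algebra.IsIntegral T T'] {n : Ideal T}
    (hn : IsMinimalRegularPrime n) :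
    ∃ N : Ideal T', IsMinimalRegularPrime N ∧ N.under T = n := by
  have : n.IsPrime := hn.1.1
  have hinj : Function.Injective (algebraMap T T') := by
    have := IsFractionRing.injective T K
    rw [IsScalarTower.algebraMap_eq T T' K, RingHom.coe_comp] at this
    exact this.of_comp
  obtain ⟨N, -, hN, hNn⟩ := Ideal.exists_ideal_over_prime_of_isIntegral (S := T') n ⊥
    ((Ideal.comap_bot_of_injective _ hinj).trans_le bot_le)
  refine ⟨N, ⟨⟨hN, (isRegularIdeal_under_iff K).1 (hNn ▸ hn.1.2)⟩, ?_⟩, hNn⟩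
  rintro N' ⟨hN', hreg⟩ hle
  by_contra hnle
  have hlt : N'.under T < n := hNn ▸ Ideal.IsIntegral.comap_lt_comap (lt_of_le_not_ge hle hnle)
  exact hlt.not_ge (hn.2 ⟨inferInstance, (isRegularIdeal_under_iff K).2 hreg⟩ hlt.le)

end MinimalRegularPrime

section RegularQuotient

variable {A K : Type*} [CommRing A] [CommRing K] [Algebra A K] [IsFractionRing A K]
  (P : Ideal A) [P.IsPrime]

instance regularQuotient.isLocalization :
    IsLocalization (P.primeCompl ⊓ A⁰) (regularQuotient K P) :=
  Localization.subalgebra.isLocalization_subalgebra K _ inf_le_right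

instance regularQuotient.isNoetherianRing [IsNoetherianRing A] :
    IsNoetherianRing (regularQuotient K P) :=
  IsLocalization.isNoetherianRing (P.primeCompl ⊓ A⁰) _ ‹_›

variable {P}

theorem mem_regularQuotient_iff {x : K} : x ∈ regularQuotient K P ↔
    ∃ s ∈ P.primeCompl ⊓ A⁰, ∃ a, algebraMap A K s * x = algebraMap A K a := by
  change (∃ a s, ∃ hs : s ∈ P.primeCompl ⊓ A⁰, x = IsLocalization.mk' K a ⟨s, hs.2⟩) ↔ _
  simp only [IsLocalization.eq_mk'_iff_mul_eq, mul_comm x]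
  exact ⟨fun ⟨a, s, hs, h⟩ => ⟨s, hs, a, h⟩, fun ⟨s, hs, a, h⟩ => ⟨a, s, hs, h⟩⟩

theorem mem_of_mem_regularQuotient {T : Subalgebra A K} {I J : Ideal T} [J.IsPrime]
    (hIJ : I.under A ≤ J.under A) {x : T} (hx : x ∈ I)
    (hxJ : (x : K) ∈ regularQuotient K (J.under A)) : x ∈ J := by
  obtain ⟨s, hs, a, hsa⟩ := mem_regularQuotient_iff.1 hxJ
  have hsx : algebraMap A T s * x = algebraMap A T a := Subtype.ext hsa
  have haI : a ∈ I.under A := by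
    rw [Ideal.under_def, Ideal.mem_comap, ← hsx]
    exact I.mul_mem_left _ hx
  have haJ : algebraMap A T s * x ∈ J := hsx ▸ hIJ haI
  exact (Ideal.IsPrime.mem_or_mem ‹_› haJ).resolve_left hs.1

theorem regularQuotient_eq_top (hP : ¬ IsRegularIdeal P) : regularQuotient K P = ⊤ := by
  refine eq_top_iff.2 fun x _ => mem_regularQuotient_iff.2 ?_
  obtain ⟨⟨a, s⟩, has⟩ := IsLocalization.surj A⁰ x
  exact ⟨s, ⟨fun hs => hP ⟨s, hs, s.2⟩, s.2⟩, a, (mul_comm _ _).trans has⟩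

variable (P) in
theorem under_regularQuotient_le [IsNoetherianRing A] {p : Ideal (regularQuotient K P)}
    [hp : p.IsPrime] (hreg : IsRegularIdeal p) : p.under A ≤ P := by
  by_contra hle
  obtain ⟨x, hxp, hx, hxP⟩ :=
    ((isRegularIdeal_under_iff K).2 hreg).exists_mem_nonZeroDivisors_notMem hle
  exact Set.disjoint_left.1 ((IsLocalization.disjoint_under_iff (P.primeCompl ⊓ A⁰)
    (regularQuotient K P) p).2 hp.ne_top) ⟨hxP, hx⟩ hxp

end RegularQuotient

section GoingDown

theorem exists_isPrime_under_eq_of_le {R S : Type*} [CommRing R] [CommRing S] [Algebra R S]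
    [Algebra.HasGoingDown R S] (Q : Ideal S) [Q.IsPrime] {p : Ideal R} [p.IsPrime]
    (hp : p ≤ Q.under R) : ∃ q : Ideal S, q.IsPrime ∧ q.under R = p := by
  obtain ⟨q, -, hq, hqp⟩ := Ideal.exists_ideal_le_liesOver_of_le Q hp
  exact ⟨q, hq, hqp.over.symm⟩

variable {A K : Type*} [CommRing A] [CommRing K] [Algebra A K] [IsFractionRing A K]

variable (A K) in
/-- The integral closure `A'` of `A` in its total quotient ring `K` agrees with `A` in codimension
one: `A' ⊆ A_(N ∩ A)` for every minimal regular prime `N` of `A'`. This holds as soon as the rings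
`A_(N ∩ A)` are valuation rings on `K`. -/
def IsIntegrallyClosedInCodimOne : Prop :=
  ∀ (N : Ideal (integralClosure A K)) [N.IsPrime], IsMinimalRegularPrime N →
    integralClosure A K ≤ regularQuotient K (N.comap (algebraMap A (integralClosure A K)))

theorem IsManisDVR.integralClosure_le {R S : Type*} [CommRing R] [CommRing S] [Algebra R S]
    {V : Subalgebra R S} (hV : IsManisDVR V.toSubring) : integralClosure R S ≤ V := by
  obtain ⟨v, -, hv⟩ := hV
  have mem_V {y : S} : v y ≤ 1 ↔ y ∈ V := by
    rw [← Subalgebra.mem_toSubring, ← hv]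
    rfl
  have hint : v.Integers V :=
    ⟨Subtype.val_injective, fun y => mem_V.2 y.2, fun y hy => ⟨⟨y, mem_V.1 hy⟩, rfl⟩⟩
  exact fun x hx => mem_V.1 (hint.mem_of_integral (IsIntegral.tower_top (A := V) hx))

theorem IsIntegrallyClosedInCodimOne.le_regularQuotient_under
    (hA : IsIntegrallyClosedInCodimOne A K) (T : Subalgebra A K) [hT : Algebra.IsIntegral A T]
    {n : Ideal T} [n.IsPrime] (hn : IsMinimalRegularPrime n) :
    T ≤ regularQuotient K (n.under A) := by
  have hle : T ≤ integralClosure A K := le_integralClosure_iff_isIntegral.2 hT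
  let : Algebra T (integralClosure A K) := (Subalgebra.inclusion hle).toAlgebra
  have : IsScalarTower A T (integralClosure A K) := .of_algebraMap_eq fun _ => rfl
  have : IsScalarTower T (integralClosure A K) K := .of_algebraMap_eq fun _ => rfl
  have : Algebra.IsIntegral T (integralClosure A K) := .tower_top A
  obtain ⟨N, hN, rfl⟩ := exists_isMinimalRegularPrime_under_eq (integralClosure A K) K hn
  have : N.IsPrime := hN.1.1
  exact hle.trans (hA N hN)

-- Generalize `Q` to a prime `n` minimal over `b`, and go down from `q` to a prime `q₀` over
-- `n ∩ A`: as `b ∈ A_(n ∩ A)`, membership of `b` in `n` and in `q₀` are read off in `A`.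
theorem IsIntegrallyClosedInCodimOne.inclusion_mem (hA : IsIntegrallyClosedInCodimOne A K)
    {B T : Subalgebra A K} [Algebra.HasGoingDown A B] [IsNoetherianRing T]
    [Algebra.IsIntegral A T] (hTB : T ≤ B) {q : Ideal B} [q.IsPrime] {Q : Ideal T} [Q.IsPrime]
    (hle : Q.under A ≤ q.under A) {b : T} (hbQ : b ∈ Q) (hb : b ∈ T⁰) :
    Subalgebra.inclusion hTB b ∈ q := by
  obtain ⟨n, hn, hnQ⟩ :=
    Ideal.exists_minimalPrimes_le ((Ideal.span_singleton_le_iff_mem _).2 hbQ)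
  have : n.IsPrime := hn.1.1
  have hmin := isMinimalRegularPrime_of_mem_minimalPrimes_span_singleton hb hn
  obtain ⟨q₀, hq₀q, hq₀, hq₀n⟩ :=
    Ideal.exists_ideal_le_liesOver_of_le q ((Ideal.comap_mono hnQ).trans hle)
  have hnq₀ : n.under A = (q₀.comap (Subalgebra.inclusion hTB)).under A := hq₀n.over
  have hbn : b ∈ n := hn.1.2 (Ideal.mem_span_singleton_self b)
  have hbR := hA.le_regularQuotient_under T hmin b.2
  simp only [hnq₀] at hbR
  exact hq₀q (mem_of_mem_regularQuotient hnq₀.le hbn hbR)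

theorem IsIntegrallyClosedInCodimOne.le_comap_inclusion [IsNoetherianRing A]
    (hA : IsIntegrallyClosedInCodimOne A K) {B E : Subalgebra A K} [Algebra.HasGoingDown A B]
    [hE : Algebra.IsIntegral A E] (hEB : E ≤ B) {q : Ideal B} [q.IsPrime] {Q : Ideal E} [Q.IsPrime]
    (hle : Q.under A ≤ q.under A) (hreg : IsRegularIdeal (Q.under A)) :
    Q ≤ q.comap (Subalgebra.inclusion hEB) := by
  intro c hc
  let T : Subalgebra A K := Algebra.adjoin A {(c : K)}
  have hTE : T ≤ E := Algebra.adjoin_le (Set.singleton_subset_iff.2 c.2)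
  have : IsNoetherianRing T := isNoetherianRing_of_fg ⟨{(c : K)}, by rw [Finset.coe_singleton]⟩
  have : Algebra.IsIntegral A T :=
    le_integralClosure_iff_isIntegral.1 (hTE.trans (le_integralClosure_iff_isIntegral.2 hE))
  let QT : Ideal T := Q.comap (Subalgebra.inclusion hTE)
  let qT : Ideal T := q.comap (Subalgebra.inclusion (hTE.trans hEB))
  suffices QT ≤ qT from this (x := ⟨c, Algebra.self_mem_adjoin_singleton A _⟩) hc
  by_contra hnle
  obtain ⟨b, hbQ, hb, hbq⟩ := ((isRegularIdeal_under_iff (I := QT) K).1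
    hreg).exists_mem_nonZeroDivisors_notMem hnle
  exact hbq (hA.inclusion_mem (Q := QT) (hTE.trans hEB) hle hbQ hb)

theorem IsIntegrallyClosedInCodimOne.eq_of_under_eq [IsNoetherianRing A]
    (hA : IsIntegrallyClosedInCodimOne A K) {B E : Subalgebra A K} [Algebra.HasGoingDown A B]
    [Algebra.IsIntegral A E] (hEB : E ≤ B) {Q₁ Q₂ : Ideal E} [Q₁.IsPrime] [Q₂.IsPrime]
    (h : Q₁.under A = Q₂.under A)
    (hB : IsRegularIdeal (Q₁.under A) → ∃ q : Ideal B, q.IsPrime ∧ q.under A = Q₁.under A) :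
    Q₁ = Q₂ := by
  by_cases hreg : IsRegularIdeal (Q₁.under A)
  · obtain ⟨q, hq, hqQ⟩ := hB hreg
    have eq_comap (Q : Ideal E) [Q.IsPrime] (hQ : Q.under A = Q₁.under A) :
        Q = q.comap (Subalgebra.inclusion hEB) := by
      have hle := hA.le_comap_inclusion hEB (hQ.trans hqQ.symm).le (hQ ▸ hreg)
      by_contra hne
      exact (Ideal.IsIntegral.comap_lt_comap (R := A) (lt_of_le_of_ne hle hne)).ne
        (hQ.trans hqQ.symm)
    exact (eq_comap Q₁ rfl).trans (eq_comap Q₂ h.symm).symm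
  · have le_of_under_le {I J : Ideal E} [J.IsPrime] (hIJ : I.under A ≤ J.under A)
        (hJ : ¬ IsRegularIdeal (J.under A)) : I ≤ J := fun _ hx =>
      mem_of_mem_regularQuotient hIJ hx (regularQuotient_eq_top (K := K) hJ ▸ Algebra.mem_top)
    exact le_antisymm (le_of_under_le h.le (h ▸ hreg)) (le_of_under_le h.ge hreg)

end GoingDown

section LocalizedOverring

variable {A K : Type*} [CommRing A] [CommRing K] [Algebra A K] [IsFractionRing A K]
  (P : Ideal A) [P.IsPrime]

/-- The localization of an overring `B` of `A` at the regular elements of `A` outside `P`, as an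
overring of `A_(P)`. -/
noncomputable def localizedOverring (B : Subalgebra A K) : Subalgebra (regularQuotient K P) K where
  carrier := {x | ∃ s ∈ P.primeCompl ⊓ A⁰, algebraMap A K s * x ∈ B}
  mul_mem' := by
    rintro x y ⟨s, hs, hsx⟩ ⟨t, ht, hty⟩
    refine ⟨s * t, mul_mem hs ht, ?_⟩
    rw [map_mul, mul_mul_mul_comm]
    exact mul_mem hsx hty
  add_mem' := by
    rintro x y ⟨s, hs, hsx⟩ ⟨t, ht, hty⟩
    refine ⟨s * t, mul_mem hs ht, ?_⟩
    rw [map_mul, mul_add, mul_right_comm, mul_assoc _ _ y]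
    exact add_mem (mul_mem hsx (B.algebraMap_mem t)) (mul_mem (B.algebraMap_mem s) hty)
  algebraMap_mem' r := by
    obtain ⟨s, hs, a, hsa⟩ := mem_regularQuotient_iff.1 r.2
    exact ⟨s, hs, hsa ▸ B.algebraMap_mem a⟩

variable (B : Subalgebra A K)

variable {B} in
theorem mem_localizedOverring_of_mem {x : K} (hx : x ∈ B) : x ∈ localizedOverring P B :=
  ⟨1, one_mem _, by rwa [map_one, one_mul]⟩

noncomputable instance localizedOverring.instAlgebra : Algebra B (localizedOverring P B) :=
  ((algebraMap B K).codRestrict (localizedOverring P B) fun x =>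
    mem_localizedOverring_of_mem P x.2).toAlgebra

instance localizedOverring.isScalarTower : IsScalarTower A B (localizedOverring P B) :=
  .of_algebraMap_eq fun _ => rfl

instance localizedOverring.isLocalization :
    IsLocalization (Algebra.algebraMapSubmonoid B (P.primeCompl ⊓ A⁰)) (localizedOverring P B) where
  map_units := by
    rintro ⟨_, s, hs, rfl⟩
    exact (IsLocalization.map_units (regularQuotient K P) (⟨s, hs⟩ : ↥(P.primeCompl ⊓ A⁰))).map
      (algebraMap (regularQuotient K P) (localizedOverring P B))
  surj := by
    rintro ⟨x, s, hs, hsx⟩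
    exact ⟨(⟨_, hsx⟩, ⟨_, s, hs, rfl⟩), Subtype.ext (mul_comm _ _)⟩
  exists_of_eq h :=
    ⟨1, congrArg _ (Subtype.ext (congrArg (Subtype.val : localizedOverring P B → K) h))⟩

theorem localizedOverring_inf_integralClosure :
    localizedOverring P (B ⊓ integralClosure A K) =
      localizedOverring P B ⊓ integralClosure (regularQuotient K P) K := by
  ext x
  constructor
  · rintro ⟨s, hs, hsB, hsA⟩
    obtain ⟨u, hu⟩ :=
      IsLocalization.map_units (regularQuotient K P) (⟨s, hs⟩ : ↥(P.primeCompl ⊓ A⁰))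
    have hux : u • x = algebraMap A K s * x := by
      rw [Units.smul_def, hu, algebraMap_smul, Algebra.smul_def]
    rw [← inv_smul_smul u x, hux]
    exact ⟨Subalgebra.smul_mem _ (mem_localizedOverring_of_mem P hsB) _,
      Subalgebra.smul_mem _ (IsIntegral.tower_top (A := regularQuotient K P) hsA) _⟩
  · rintro ⟨⟨s, hs, hsB⟩, hx⟩
    obtain ⟨⟨t, ht⟩, htx⟩ :=
      IsIntegral.exists_multiple_integral_of_isLocalization (P.primeCompl ⊓ A⁰) x hx
    rw [Submonoid.mk_smul, Algebra.smul_def] at htx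
    refine ⟨s * t, mul_mem hs ht, ?_, ?_⟩
    · rw [map_mul, mul_right_comm]
      exact mul_mem hsB (B.algebraMap_mem t)
    · rw [map_mul, mul_assoc]
      exact mul_mem (Subalgebra.algebraMap_mem _ s) htx

variable {P} {B}

theorem under_map_localizedOverring_eq {p : Ideal (regularQuotient K P)} (hp : p ≠ ⊤)
    {q : Ideal B} [hq : q.IsPrime] (hqp : q.under A = p.under A) :
    (q.map (algebraMap B (localizedOverring P B))).under (regularQuotient K P) = p := by
  let S := P.primeCompl ⊓ A⁰
  have hdisj : Disjoint (Algebra.algebraMapSubmonoid B S : Set B) q := by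
    have hdisjA := (IsLocalization.disjoint_under_iff S (regularQuotient K P) p).2 hp
    rw [← hqp] at hdisjA
    exact Set.disjoint_image_left.2 hdisjA
  apply (IsLocalization.orderEmbedding S (regularQuotient K P)).injective
  calc ((q.map (algebraMap B (localizedOverring P B))).under (regularQuotient K P)).under A
      = ((q.map (algebraMap B (localizedOverring P B))).under B).under A := rfl
    _ = q.under A := by
      rw [IsLocalization.under_map_of_isPrime_disjoint (Algebra.algebraMapSubmonoid B S) _ hq hdisj]
    _ = p.under A := hqp

end LocalizedOverring

section Unibranched

variable {A K : Type*} [CommRing A] [CommRing K] [Algebra A K] [IsFractionRing A K]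

theorem IsUnibranched.hasGoingDown {R S : Type*} [CommRing R] [CommRing S] [Algebra R S]
    [Algebra.IsIntegral R S] (h : IsUnibranched R S) : Algebra.HasGoingDown R S where
  exists_ideal_le_liesOver_of_lt {p} hp Q hQ hlt := by
    obtain ⟨⟨Q₀, hQ₀⟩, hQ₀p⟩ := h.2 ⟨p, hp⟩
    have hQ₀p' : Q₀.comap (algebraMap R S) = p := congrArg PrimeSpectrum.asIdeal hQ₀p
    obtain ⟨Q₁, hle, hQ₁, hQ₁Q⟩ := Ideal.exists_ideal_over_prime_of_isIntegral_of_isPrime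
      (Q.under R) Q₀ (hQ₀p'.le.trans hlt.le)
    have hQQ : Q₁ = Q := congrArg PrimeSpectrum.asIdeal
      (h.1 (PrimeSpectrum.ext hQ₁Q) : (⟨Q₁, hQ₁⟩ : PrimeSpectrum S) = ⟨Q, hQ⟩)
    exact ⟨Q₀, hQQ ▸ hle, hQ₀, ⟨hQ₀p'.symm⟩⟩

theorem IsIntegrallyClosedInCodimOne.isUnibranched_inf_integralClosure [IsNoetherianRing A]
    (hA : IsIntegrallyClosedInCodimOne A K) (B : Subalgebra A K) [Algebra.HasGoingDown A B]
    (Q : Ideal B) [Q.IsPrime] :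
    IsUnibranched (regularQuotient K (Q.under A))
      (localizedOverring (Q.under A) B ⊓ integralClosure (regularQuotient K (Q.under A)) K :
        Subalgebra (regularQuotient K (Q.under A)) K) := by
  let R := regularQuotient K (Q.under A)
  let E := B ⊓ integralClosure A K
  let D := localizedOverring (Q.under A) E
  have hDR : D = localizedOverring (Q.under A) B ⊓ integralClosure R K :=
    localizedOverring_inf_integralClosure (Q.under A) B
  have : Algebra.IsIntegral A E := le_integralClosure_iff_isIntegral.1 inf_le_right
  have : Algebra.IsIntegral R D :=
    le_integralClosure_iff_isIntegral.1 (hDR.trans_le inf_le_right)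
  have : FaithfulSMul R D := (faithfulSMul_iff_algebraMap_injective R D).2 fun _ _ h =>
    Subtype.ext (congrArg (Subtype.val : D → K) h)
  rw [← hDR]
  refine ⟨fun Q₁ Q₂ h => PrimeSpectrum.ext ?_, Algebra.IsIntegral.comap_surjective R D⟩
  have hR : Q₁.asIdeal.under R = Q₂.asIdeal.under R := congrArg PrimeSpectrum.asIdeal h
  have hE : (Q₁.asIdeal.under E).under A = (Q₂.asIdeal.under E).under A :=
    congrArg (fun I : Ideal R => I.under A) hR
  apply (IsLocalization.orderEmbedding
    (Algebra.algebraMapSubmonoid E ((Q.under A).primeCompl ⊓ A⁰)) D).injective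
  refine hA.eq_of_under_eq (Q₁ := Q₁.asIdeal.under E) (Q₂ := Q₂.asIdeal.under E) inf_le_left hE
    fun hreg => exists_isPrime_under_eq_of_le Q ?_
  exact under_regularQuotient_le (Q.under A) (p := Q₁.asIdeal.under R)
    ((isRegularIdeal_under_iff K).1 hreg)

end Unibranched

section Integrality

theorem isIntegral_of_mul_mem_of_isUnit_mem {R S : Type*} [CommRing R] [CommRing S] [Algebra R S]
    {M : Submodule R S} (hM : M.FG) {u : S} (huM : u ∈ M) (hu : IsUnit u) {y : S}
    (hy : ∀ m ∈ M, y * m ∈ M) : IsIntegral R y := by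
  obtain ⟨f, hf⟩ : ∃ f : Module.End R M, ∀ m, (f m : S) = y * m :=
    ⟨(LinearMap.mulLeft R y).restrict hy, fun _ => rfl⟩
  have : Module.Finite R M := Module.Finite.iff_fg.2 hM
  obtain ⟨χ, hχ, hχf⟩ := LinearMap.exists_monic_and_aeval_eq_zero R f
  have aeval_apply (p : Polynomial R) (m : M) :
      (Polynomial.aeval f p m : S) = Polynomial.aeval y p * m := by
    induction p using Polynomial.induction_on generalizing m with
    | C r => simp [Algebra.smul_def]
    | add p q hp hq => simp [hp, hq, add_mul]
    | monomial n r ih => simpa [pow_succ, hf, mul_assoc] using ih (f m)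
  refine ⟨χ, hχ, hu.mul_left_injective ?_⟩
  simpa [← Polynomial.aeval_def, hχf] using (aeval_apply χ ⟨u, huM⟩).symm

variable {R K : Type*} [CommRing R] [IsNoetherianRing R] [CommRing K] [Algebra R K]

theorem exists_isPrime_mem_iff_mul_mem_bot {C : Subalgebra R K} (hC : C ≠ ⊥) :
    ∃ y ∈ C, ∃ p : Ideal R, p.IsPrime ∧
      ∀ r, r ∈ p ↔ algebraMap R K r * y ∈ (⊥ : Subalgebra R K) := by
  let M : Submodule R C := (Subalgebra.toSubmodule ⊥).comap C.val.toLinearMap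
  obtain ⟨x, hxC, hx⟩ := SetLike.not_le_iff_exists.1 (mt le_bot_iff.1 hC)
  have hx0 : M.mkQ ⟨x, hxC⟩ ≠ 0 := mt (Submodule.Quotient.mk_eq_zero M).1 hx
  obtain ⟨p, hp, -⟩ := exists_le_isAssociatedPrime_of_isNoetherianRing R _ hx0
  obtain ⟨hp, y', rfl⟩ := isAssociatedPrime_iff.1 hp
  obtain ⟨y, rfl⟩ := M.mkQ_surjective y'
  refine ⟨y, y.2, _, hp, fun r => ?_⟩
  rw [Submodule.mem_colon_singleton, Submodule.mem_bot, ← map_smul, Submodule.mkQ_apply,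
    Submodule.Quotient.mk_eq_zero, ← Algebra.smul_def]
  rfl

theorem eq_bot_of_inf_integralClosure_eq_bot [IsFractionRing R K] {C : Subalgebra R K}
    (hC : ∀ p : Ideal R, p.IsPrime → IsRegularIdeal p → ∃ q : Ideal C, q.under R = p)
    (hint : C ⊓ integralClosure R K = ⊥) : C = ⊥ := by
  by_contra hne
  obtain ⟨y, hyC, p, hp, hpy⟩ := exists_isPrime_mem_iff_mul_mem_bot hne
  have hreg : IsRegularIdeal p := by
    obtain ⟨⟨a, s⟩, has⟩ := IsLocalization.surj R⁰ y
    exact ⟨s, (hpy s).2 (Algebra.mem_bot.2 ⟨a, has.symm.trans (mul_comm _ _)⟩), s.2⟩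
  obtain ⟨q, rfl⟩ := hC p hp hreg
  have hpy_mem {r : R} (hr : r ∈ q.under R) :
      ∃ a ∈ q.under R, algebraMap R K a = y * algebraMap R K r := by
    obtain ⟨a, ha⟩ := Algebra.mem_bot.1 ((hpy r).1 hr)
    refine ⟨a, ?_, ha.trans (mul_comm _ _)⟩
    have haC : algebraMap R C a = algebraMap R C r * ⟨y, hyC⟩ := Subtype.ext ha
    rw [Ideal.under_def, Ideal.mem_comap, haC]
    exact q.mul_mem_right _ hr
  have hy : IsIntegral R y := by
    obtain ⟨t, htp, ht⟩ := hreg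
    refine isIntegral_of_mul_mem_of_isUnit_mem
      (M := Submodule.map (Algebra.linearMap R K) (q.under R))
      ((IsNoetherian.noetherian _).map _) (Submodule.mem_map_of_mem htp)
      ((mem_nonZeroDivisors_iff_isUnit_algebraMap R K).1 ht) ?_
    rintro _ ⟨r, hr, rfl⟩
    exact hpy_mem hr
  have hybot : y ∈ (⊥ : Subalgebra R K) := hint ▸ ⟨hyC, hy⟩
  exact hp.ne_top ((Ideal.eq_top_iff_one _).2 ((hpy 1).2 (by rwa [map_one, one_mul])))

end Integrality

section Flatness

theorem eq_bot_of_faithfullyFlat {R K : Type*} [CommRing R] [CommRing K] [Algebra R K]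
    [IsFractionRing R K] (B : Subalgebra R K) [Module.FaithfullyFlat R B] : B = ⊥ := by
  refine eq_bot_iff.2 fun x hx => ?_
  obtain ⟨⟨a, s⟩, has⟩ := IsLocalization.surj R⁰ x
  have ha : a ∈ ((Ideal.span {(s : R)}).map (algebraMap R B)).comap (algebraMap R B) := by
    rw [Ideal.mem_comap, Ideal.map_span, Set.image_singleton, Ideal.mem_span_singleton]
    exact ⟨⟨x, hx⟩, Subtype.ext (has.symm.trans (mul_comm _ _))⟩
  rw [Ideal.comap_map_eq_self_of_faithfullyFlat, Ideal.mem_span_singleton] at ha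
  obtain ⟨r, rfl⟩ := ha
  have hs : IsUnit (algebraMap R K s) := IsLocalization.map_units K s
  rw [map_mul, mul_comm] at has
  exact Algebra.mem_bot.2 ⟨r, (hs.mul_left_cancel has).symm⟩

variable {A K : Type*} [CommRing A] [CommRing K] [Algebra A K] [IsFractionRing A K]

theorem flat_of_forall_flat_localizedOverring {B : Subalgebra A K}
    (h : ∀ (Q : Ideal B) [Q.IsMaximal],
      Module.Flat (regularQuotient K (Q.under A)) (localizedOverring (Q.under A) B)) :
    Module.Flat A B := by
  refine Module.flat_of_isLocalized_maximal B B (fun Q => Localization.AtPrime Q)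
    (fun Q => Algebra.linearMap B _) fun Q _ => ?_
  let C := localizedOverring (Q.under A) B
  let S := (Q.under A).primeCompl ⊓ A⁰
  have hle : Algebra.algebraMapSubmonoid B S ≤ Q.primeCompl := by
    rintro _ ⟨s, hs, rfl⟩
    exact hs.1
  let : Algebra C (Localization.AtPrime Q) :=
    IsLocalization.localizationAlgebraOfSubmonoidLe C (Localization.AtPrime Q) _ _ hle
  have : IsScalarTower B C (Localization.AtPrime Q) :=
    IsLocalization.localization_isScalarTower_of_submonoid_le C (Localization.AtPrime Q) _ _ hle
  have : IsScalarTower A C (Localization.AtPrime Q) := .of_algebraMap_eq fun a => by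
    rw [IsScalarTower.algebraMap_apply A B C, ← IsScalarTower.algebraMap_apply B C,
      ← IsScalarTower.algebraMap_apply]
  have : IsLocalization (Q.primeCompl.map (algebraMap B C)) (Localization.AtPrime Q) :=
    IsLocalization.isLocalization_of_submonoid_le C (Localization.AtPrime Q) _ _ hle
  have : Module.Flat C (Localization.AtPrime Q) :=
    IsLocalization.flat _ (Q.primeCompl.map (algebraMap B C))
  have : Module.Flat A (regularQuotient K (Q.under A)) := IsLocalization.flat _ S
  have := h Q
  have : Module.Flat A C := .trans A (regularQuotient K (Q.under A)) C
  exact .trans A C (Localization.AtPrime Q)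

end Flatness

section Perinormal

variable {A K : Type*} [CommRing A] [CommRing K] [Algebra A K] [IsFractionRing A K]

theorem IsPerinormal.eq_bot_of_isUnibranched (hA : IsPerinormal A K) {P : Ideal A} [P.IsPrime]
    {B : Subalgebra (regularQuotient K P) K} [Algebra.IsIntegral (regularQuotient K P) B]
    (hB : IsUnibranched (regularQuotient K P) B) : B = ⊥ := by
  have : Module.Flat A (regularQuotient K P) := IsLocalization.flat _ (P.primeCompl ⊓ A⁰)
  have : Algebra.HasGoingDown (regularQuotient K P) B := hB.hasGoingDown
  have : Algebra.HasGoingDown A (B.restrictScalars A) :=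
    Algebra.HasGoingDown.trans (R := A) (S := regularQuotient K P) (T := B)
  have : Module.Flat A B := hA _ this
  have : Module.Flat (regularQuotient K P) B :=
    (Module.flat_iff_of_isLocalization (regularQuotient K P) (P.primeCompl ⊓ A⁰) B).2 this
  have : Module.FaithfullyFlat (regularQuotient K P) B := .of_comap_surjective hB.2
  exact eq_bot_of_faithfullyFlat B

theorem IsIntegrallyClosedInCodimOne.isPerinormal [IsNoetherianRing A]
    (hA : IsIntegrallyClosedInCodimOne A K)
    (h : ∀ (P : Ideal A) [P.IsPrime] (B : Subalgebra (regularQuotient K P) K),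
      Algebra.IsIntegral (regularQuotient K P) B → IsUnibranched (regularQuotient K P) B →
        B = ⊥) : IsPerinormal A K := by
  intro B hB
  refine flat_of_forall_flat_localizedOverring fun Q _ => ?_
  have hD :
      localizedOverring (Q.under A) B ⊓ integralClosure (regularQuotient K (Q.under A)) K = ⊥ :=
    h _ _ (le_integralClosure_iff_isIntegral.1 inf_le_right)
      (hA.isUnibranched_inf_integralClosure B Q)
  have hC : localizedOverring (Q.under A) B = ⊥ := by
    refine eq_bot_of_inf_integralClosure_eq_bot (fun p hp hreg => ?_) hD
    obtain ⟨q, hq, hqp⟩ := exists_isPrime_under_eq_of_le Q (under_regularQuotient_le _ hreg)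
    exact ⟨_, under_map_localizedOverring_eq hp.ne_top hqp⟩
  rw [hC]
  exact .of_linearEquiv (Algebra.botEquivOfInjective Subtype.val_injective).toLinearEquiv

end Perinormal

theorem theorem28_general {A K : Type*} [CommRing A] [IsNoetherianRing A] [CommRing K]
    [Algebra A K] [IsFractionRing A K] (hA : IsIntegrallyClosedInCodimOne A K) :
    IsPerinormal A K ↔
      ∀ (P : Ideal A) [P.IsPrime] (B : Subalgebra (regularQuotient K P) K),
        Algebra.IsIntegral (regularQuotient K P) B → IsUnibranched (regularQuotient K P) B →
          B = ⊥ :=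
  ⟨fun h _ _ _ _ hB => h.eq_bot_of_isUnibranched hB, hA.isPerinormal⟩

/-- Overrings of `A_(P)` are the `A_(P)`-subalgebras `B` of `K`; `B = ⊥` says `B = A_(P)`. -/
theorem theorem28 {A K : Type*} [CommRing A] [IsNoetherianRing A] [CommRing K] [Algebra A K]
    [IsFractionRing A K]
    (hA : ∀ (P : Ideal (integralClosure A K)) [P.IsPrime], IsMinimalRegularPrime P →
      IsManisDVR (regularQuotient K (P.comap (algebraMap A (integralClosure A K)))).toSubring) :
    IsPerinormal A K ↔
      ∀ (P : Ideal A) [P.IsPrime] (B : Subalgebra (regularQuotient K P) K),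
        Algebra.IsIntegral (regularQuotient K P) B → IsUnibranched (regularQuotient K P) B →
          B = ⊥ :=
  theorem28_general fun N _ hN => (hA N hN).integralClosure_le
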